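/- For real $x$ and an integer $d\ge 1$ let $G(x,d)$ be the number of pairs of primes $p,p'\le x$ with $p'-p=d$. A prime difference champion for primes $\le x$ is a positive integer $d^*$ at which $G(x,d)$ attains its maximum over all integers $d\ge 1$. **Theorem 2.** Unconditionally, suppose that $d^*=d^*(x)$ is a prime difference champion for primes $\le x$, for all sufficiently large $x$. Then $d^*(x)\to\infty$ as $x\to\infty$, and the number of distinct prime factors of $d^*(x)$ also tends to infinity as $x\to\infty$. Moreover, $$\sum_{p\mid d^*}\frac1p\gg\log\log\log x ,$$ that is, there are absolute constants $c>0$ and $x_0$ such that $\sum_{p\mid d^*}\frac1p\ge c\log\log\log x$ for every $x\ge x_0$ and every prime difference champion $d^*$ for primes $\le x$, the sum being over the distinct primes dividing $d^*$. -/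

import Mathlib

/-- `G(x, d)`: the number of pairs `(p, p')` of primes, both at most `x`, with `p' - p = d`
(written `p + d = p'`, so that no truncated subtraction occurs). -/
noncomputable def primeDifferenceCount (x : ℝ) (d : ℕ) : ℕ :=
  ((Finset.range (⌊x⌋₊ + 1) ×ˢ Finset.range (⌊x⌋₊ + 1)).filter
    (fun q : ℕ × ℕ => q.1.Prime ∧ q.2.Prime ∧ q.1 + d = q.2)).card

/-- `D*(x)`: the set of prime difference champions for primes up to `x`, that is, the positive
integers `d` at which `G(x, d)` attains its maximum over all positive integers. -/
def primeDifferenceChampions (x : ℝ) : Set ℕ :=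
  {d : ℕ | 0 < d ∧ ∀ e : ℕ, 0 < e → primeDifferenceCount x e ≤ primeDifferenceCount x d}

/-- The maximum is attained: there is always at least one champion. -/
theorem primeDifferenceChampions_nonempty (x : ℝ) : (primeDifferenceChampions x).Nonempty := by
  have hb : ∀ e : ℕ, primeDifferenceCount x e ≤
      (Finset.range (⌊x⌋₊ + 1) ×ˢ Finset.range (⌊x⌋₊ + 1)).card :=
    fun e => Finset.card_filter_le _ _
  obtain ⟨m, ⟨d, hd, rfl⟩, hm⟩ := Nat.sSup_mem
    (s := primeDifferenceCount x '' {e : ℕ | 0 < e}) ⟨_, 1, Nat.one_pos, rfl⟩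
    ⟨_, by rintro _ ⟨e, _, rfl⟩; exact hb e⟩ |> fun h => (⟨_, h, rfl⟩ :
      ∃ m, m ∈ primeDifferenceCount x '' {e : ℕ | 0 < e} ∧
        m = sSup (primeDifferenceCount x '' {e : ℕ | 0 < e}))
  refine ⟨d, hd, fun e he => ?_⟩
  rw [hm]
  exact le_csSup ⟨_, by rintro _ ⟨e, _, rfl⟩; exact hb e⟩ ⟨e, he, rfl⟩

open Finset Filter

/-! Two estimates are played against each other. Upper bound: Selberg's sieve applied to the values
n(n+d) gives, uniformly in even d, G(x,d) ≪ x/(log x)² · B(d)², where B(d) = ∏_{p∣d} (1 + 1/p)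
(`primeDifferenceCount_le`, `eventually_primeDifferenceCount_le`). The sieve has a crude error z⁶,
harmless because the level is a small power of x. All dependence on d comes from the main term: the
Selberg sum dominates (∑ 1/m)² over small squarefree m coprime to d, and dropping the coprimality
costs a factor B(d).

Lower bound: let P be the product of the primes up to w, with w about (log x)/8. The primes in (w,
x] occupy only φ(P) classes modulo P, so by Cauchy–Schwarz many pairs are congruent modulo P
(`sq_card_le_totient_mul`). Their nonzero differences are among the at most x/P multiples of P, so
some multiple is a difference often. As φ(P)/P ≪ 1/log w, the maximum of G is ≫ x log log x/(log x)²
(`eventually_champion_count_ge`).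

For a champion d the two bounds force B(d)² ≫ log log x. Since B(d) ≤ exp(∑_{p∣d} 1/p), taking
logarithms gives ∑_{p∣d} 1/p ≫ log log log x. Each summand is at most 1, so d has many prime
factors, and hence is large. -/

open Finset ArithmeticFunction in
theorem sum_moebius_between {l m : ℕ} (hm : Squarefree m) (hl : l ∣ m) :
    ∑ d ∈ m.divisors with l ∣ d, (ArithmeticFunction.moebius d : ℝ) =
      if l = m then (ArithmeticFunction.moebius l : ℝ) else 0 := by
  obtain ⟨k, rfl⟩ := hl
  have hlk : l.Coprime k := Nat.coprime_of_squarefree_mul hm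
  have hl0 : l ≠ 0 := left_ne_zero_of_mul hm.ne_zero
  have hk0 : k ≠ 0 := right_ne_zero_of_mul hm.ne_zero
  have himg : ((l * k).divisors.filter (l ∣ ·)) = k.divisors.image (l * ·) := by
    ext d
    simp only [mem_filter, Nat.mem_divisors, mem_image]
    constructor
    · rintro ⟨⟨h1, -⟩, e, rfl⟩
      exact ⟨e, ⟨Nat.dvd_of_mul_dvd_mul_left (Nat.pos_of_ne_zero hl0) h1, hk0⟩, rfl⟩
    · rintro ⟨e, ⟨he, -⟩, rfl⟩
      exact ⟨⟨mul_dvd_mul_left l he, hm.ne_zero⟩, dvd_mul_right _ _⟩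
  rw [himg, sum_image (fun a _ b _ h => Nat.eq_of_mul_eq_mul_left (Nat.pos_of_ne_zero hl0) h)]
  have h1 : ∀ e ∈ k.divisors, (ArithmeticFunction.moebius (l * e) : ℝ) =
      (ArithmeticFunction.moebius l : ℝ) * (ArithmeticFunction.moebius e : ℝ) := by
    intro e he
    rw [isMultiplicative_moebius.map_mul_of_coprime
      (hlk.coprime_dvd_right (Nat.dvd_of_mem_divisors he))]
    push_cast; rfl
  rw [sum_congr rfl h1, ← mul_sum]
  have h2 : ∑ e ∈ k.divisors, (ArithmeticFunction.moebius e : ℝ) = if k = 1 then 1 else 0 := by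
    have h : ∑ e ∈ k.divisors, moebius e = if k = 1 then 1 else 0 := by
      rw [← coe_mul_zeta_apply, moebius_mul_coe_zeta, one_apply]
    exact_mod_cast congrArg (Int.cast (R := ℝ)) h
  rw [h2]
  by_cases hk : k = 1
  · simp [hk]
  · have : l ≠ l * k := by
      intro h
      apply hk
      exact Nat.eq_of_mul_eq_mul_left (Nat.pos_of_ne_zero hl0) (by omega)
    simp [hk, this]

/-! ### Selberg's Λ² sieve with its optimal weights. -/

namespace BoundingSieve

/-- The divisors of `P` of size at most `z`. -/
def smallDivisors (P z : ℕ) : Finset ℕ := P.divisors.filter (· ≤ z)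

/-- The sum `∑ g(l)` over the divisors `l ≤ z` of the sifting product. -/
noncomputable def selbergSum (s : BoundingSieve) (z : ℕ) : ℝ :=
  ∑ l ∈ smallDivisors s.prodPrimes z, s.selbergTerms l

/-- The optimal weights for the `Λ²` sieve of level `z`. -/
noncomputable def optimalWeights (s : BoundingSieve) (z d : ℕ) : ℝ :=
  ArithmeticFunction.moebius d * (s.nu d)⁻¹ * (s.selbergSum z)⁻¹ *
    ∑ l ∈ smallDivisors s.prodPrimes z with d ∣ l, s.selbergTerms l

variable (s : BoundingSieve) {z : ℕ}

theorem selbergSum_pos (hz : 1 ≤ z) : 0 < s.selbergSum z := by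
  refine sum_pos (fun l hl => ?_) ⟨1, ?_⟩
  · exact selbergTerms_pos (Nat.dvd_of_mem_divisors (mem_filter.1 hl).1)
  · simp [smallDivisors, hz, prodPrimes_ne_zero]

theorem optimalWeights_one (hz : 1 ≤ z) : s.optimalWeights z 1 = 1 := by
  have h := (s.selbergSum_pos hz).ne'
  simp only [optimalWeights, one_dvd, filter_true, s.nu_mult.map_one]
  change _ * s.selbergSum z = 1
  simp [h]

/-- Möbius inversion on the divisors of the sifting product: these sums are the variables that
diagonalise the quadratic form of the main term, and the weights are designed to give them this
value. -/
theorem sum_nu_mul_optimalWeights {l : ℕ} (hl : l ∣ s.prodPrimes) :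
    (∑ d ∈ s.prodPrimes.divisors, if l ∣ d then s.nu d * s.optimalWeights z d else 0) =
      if l ≤ z then (s.selbergSum z)⁻¹ * ArithmeticFunction.moebius l * s.selbergTerms l
      else 0 := by
  have h1 : ∀ d ∈ s.prodPrimes.divisors,
      (if l ∣ d then s.nu d * s.optimalWeights z d else 0) =
      ∑ m ∈ smallDivisors s.prodPrimes z, (s.selbergSum z)⁻¹ * (s.selbergTerms m *
        if d ∣ m ∧ l ∣ d then (ArithmeticFunction.moebius d : ℝ) else 0) := by
    intro d hd
    have hnu := s.nu_ne_zero (Nat.dvd_of_mem_divisors hd)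
    by_cases hld : l ∣ d
    · simp only [hld, if_true, and_true, optimalWeights, sum_filter, mul_sum]
      refine sum_congr rfl fun m _ => ?_
      split_ifs
      · field_simp
      · simp
    · simp [hld]
  rw [sum_congr rfl h1, sum_comm]
  have h2 : ∀ m ∈ smallDivisors s.prodPrimes z,
      ∑ d ∈ s.prodPrimes.divisors, (s.selbergSum z)⁻¹ * (s.selbergTerms m *
        if d ∣ m ∧ l ∣ d then (ArithmeticFunction.moebius d : ℝ) else 0) =
      if l = m then (s.selbergSum z)⁻¹ * ArithmeticFunction.moebius l * s.selbergTerms l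
        else 0 := by
    intro m hm
    have hmP := Nat.dvd_of_mem_divisors (mem_filter.1 hm).1
    have hmsq := s.squarefree_of_dvd_prodPrimes hmP
    rw [← mul_sum, ← mul_sum, ← sum_filter, ← filter_filter,
      Nat.divisors_filter_dvd_of_dvd prodPrimes_ne_zero hmP]
    by_cases hlm : l ∣ m
    · rw [sum_moebius_between hmsq hlm]
      split_ifs with h
      · subst h; ring
      · simp
    · have hne : l ≠ m := fun h => hlm (h ▸ dvd_rfl)
      rw [if_neg hne, filter_false_of_mem, sum_empty, mul_zero, mul_zero]
      intro d hd hld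
      exact hlm (hld.trans (Nat.dvd_of_mem_divisors hd))
  rw [sum_congr rfl h2, sum_ite_eq]
  simp [smallDivisors, hl, prodPrimes_ne_zero]

theorem mainSum_optimalWeights (hz : 1 ≤ z) :
    s.mainSum (lambdaSquared (s.optimalWeights z)) = (s.selbergSum z)⁻¹ := by
  have hS := (s.selbergSum_pos hz).ne'
  rw [mainSum_lambdaSquared_eq_sum_mul_sum_sq]
  have h : ∀ l ∈ s.prodPrimes.divisors, (s.selbergTerms l)⁻¹ *
      (∑ d ∈ s.prodPrimes.divisors, if l ∣ d then s.nu d * s.optimalWeights z d else 0) ^ 2 =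
      if l ≤ z then ((s.selbergSum z)⁻¹) ^ 2 * s.selbergTerms l else 0 := by
    intro l hl
    have hlP := Nat.dvd_of_mem_divisors hl
    rw [s.sum_nu_mul_optimalWeights hlP]
    have hg := (selbergTerms_pos hlP).ne'
    have hmu : (ArithmeticFunction.moebius l : ℝ) ^ 2 = 1 := by
      have := ArithmeticFunction.moebius_sq_eq_one_of_squarefree (s.squarefree_of_dvd_prodPrimes hlP)
      exact_mod_cast this
    split_ifs
    · rw [mul_pow, mul_pow, hmu]; field_simp
    · simp
  rw [sum_congr rfl h, ← sum_filter, ← mul_sum]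
  change _ * s.selbergSum z = _
  field_simp

theorem abs_optimalWeights_le (hz : 1 ≤ z)
    (hnu : ∀ d, d ∣ s.prodPrimes → (s.nu d)⁻¹ ≤ d) {d : ℕ} (hd : d ∣ s.prodPrimes) :
    |s.optimalWeights z d| ≤ if d ≤ z then (z : ℝ) else 0 := by
  have hS := s.selbergSum_pos hz
  have hpos : ∀ l ∈ smallDivisors s.prodPrimes z, 0 ≤ s.selbergTerms l := fun l hl =>
    (selbergTerms_pos (Nat.dvd_of_mem_divisors (mem_filter.1 hl).1)).le
  have h0 : 0 ≤ ∑ l ∈ smallDivisors s.prodPrimes z with d ∣ l, s.selbergTerms l :=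
    sum_nonneg fun l hl => hpos l (mem_filter.1 hl).1
  split_ifs with hdz
  · have h1 : ∑ l ∈ smallDivisors s.prodPrimes z with d ∣ l, s.selbergTerms l ≤ s.selbergSum z :=
      sum_le_sum_of_subset_of_nonneg (filter_subset _ _) fun l hl _ => hpos l hl
    have hmu : |(ArithmeticFunction.moebius d : ℝ)| ≤ 1 := by
      have := ArithmeticFunction.abs_moebius_le_one (n := d)
      exact_mod_cast this
    have hn0 : 0 < (s.nu d)⁻¹ := inv_pos.2 (nu_pos_of_dvd_prodPrimes hd)
    rw [optimalWeights, mul_assoc, abs_mul, abs_mul, abs_of_pos hn0,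
      abs_of_nonneg (mul_nonneg (inv_nonneg.2 hS.le) h0)]
    have h2 : (s.selbergSum z)⁻¹ * ∑ l ∈ smallDivisors s.prodPrimes z with d ∣ l,
        s.selbergTerms l ≤ 1 := by
      rw [inv_mul_le_iff₀ hS, mul_one]; exact h1
    calc _ ≤ 1 * (s.nu d)⁻¹ * 1 := by gcongr
      _ ≤ d := by rw [one_mul, mul_one]; exact hnu d hd
      _ ≤ z := by exact_mod_cast hdz
  · rw [optimalWeights, filter_false_of_mem, sum_empty, mul_zero, abs_zero]
    intro l hl hdl
    have hl0 : l ≠ 0 := (Nat.pos_of_mem_divisors (mem_filter.1 hl).1).ne'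
    exact hdz ((Nat.le_of_dvd (Nat.pos_of_ne_zero hl0) hdl).trans (mem_filter.1 hl).2)

/-- At most z² pairs of weights are nonzero; each pair contributes at most z · z from the weights
and z² from the remainder at the lcm. -/
theorem errSum_optimalWeights_le (hz : 1 ≤ z)
    (hnu : ∀ d, d ∣ s.prodPrimes → (s.nu d)⁻¹ ≤ d)
    (hrem : ∀ d, d ∣ s.prodPrimes → |s.rem d| ≤ d) :
    s.errSum (lambdaSquared (s.optimalWeights z)) ≤ (z : ℝ) ^ 6 := by
  set w := s.optimalWeights z
  set D := s.prodPrimes.divisors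
  have hw : ∀ d ∈ D, |w d| ≤ if d ≤ z then (z : ℝ) else 0 := fun d hd =>
    s.abs_optimalWeights_le hz hnu (Nat.dvd_of_mem_divisors hd)
  calc s.errSum (lambdaSquared w)
      ≤ ∑ d ∈ D, ∑ d1 ∈ D, ∑ d2 ∈ D,
          if d = Nat.lcm d1 d2 then |w d1| * |w d2| * |s.rem d| else 0 := by
        refine sum_le_sum fun d hd => ?_
        have hsub : d.divisors ⊆ D :=
          Nat.divisors_subset_of_dvd prodPrimes_ne_zero (Nat.dvd_of_mem_divisors hd)
        have h0 : ∀ d1 d2 : ℕ,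
            0 ≤ (if d = Nat.lcm d1 d2 then |w d1| * |w d2| * |s.rem d| else 0) := by
          intro d1 d2; split_ifs <;> positivity
        calc |lambdaSquared w d| * |s.rem d|
            ≤ (∑ d1 ∈ d.divisors, ∑ d2 ∈ d.divisors,
                |if d = Nat.lcm d1 d2 then w d1 * w d2 else 0|) * |s.rem d| := by
              gcongr
              exact (abs_sum_le_sum_abs _ _).trans (sum_le_sum fun _ _ => abs_sum_le_sum_abs _ _)
          _ = ∑ d1 ∈ d.divisors, ∑ d2 ∈ d.divisors,
                if d = Nat.lcm d1 d2 then |w d1| * |w d2| * |s.rem d| else 0 := by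
              simp_rw [sum_mul]
              refine sum_congr rfl fun _ _ => sum_congr rfl fun _ _ => ?_
              split_ifs <;> simp [abs_mul]
          _ ≤ _ := by
              refine (sum_le_sum fun d1 _ => sum_le_sum_of_subset_of_nonneg hsub
                fun d2 _ _ => h0 d1 d2).trans ?_
              exact sum_le_sum_of_subset_of_nonneg hsub
                fun d1 _ _ => sum_nonneg fun d2 _ => h0 d1 d2
    _ = ∑ d1 ∈ D, ∑ d2 ∈ D, |w d1| * |w d2| * |s.rem (Nat.lcm d1 d2)| := by
        rw [sum_comm]
        refine sum_congr rfl fun d1 hd1 => ?_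
        rw [sum_comm]
        refine sum_congr rfl fun d2 hd2 => ?_
        rw [sum_ite_eq_of_mem' D]
        exact Nat.mem_divisors.2 ⟨Nat.lcm_dvd (Nat.dvd_of_mem_divisors hd1)
          (Nat.dvd_of_mem_divisors hd2), prodPrimes_ne_zero⟩
    _ ≤ ∑ d1 ∈ D, ∑ d2 ∈ D, (if d1 ≤ z then (z : ℝ) ^ 2 else 0) *
          (if d2 ≤ z then (z : ℝ) ^ 2 else 0) := by
        refine sum_le_sum fun d1 hd1 => sum_le_sum fun d2 hd2 => ?_
        have h1 := hw d1 hd1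
        have h2 := hw d2 hd2
        by_cases hz1 : d1 ≤ z
        · by_cases hz2 : d2 ≤ z
          · simp only [hz1, hz2, if_true] at h1 h2 ⊢
            have h3 : |s.rem (Nat.lcm d1 d2)| ≤ (z : ℝ) * z := by
              refine (hrem _ (Nat.lcm_dvd (Nat.dvd_of_mem_divisors hd1)
                (Nat.dvd_of_mem_divisors hd2))).trans ?_
              have : Nat.lcm d1 d2 ≤ z * z := (Nat.le_of_dvd (Nat.mul_pos
                (Nat.pos_of_mem_divisors hd1) (Nat.pos_of_mem_divisors hd2))
                (Nat.lcm_dvd_mul d1 d2)).trans (Nat.mul_le_mul hz1 hz2)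
              exact_mod_cast this
            calc _ ≤ (z : ℝ) * z * (z * z) := by gcongr
              _ = _ := by ring
          · simp only [hz2, if_false] at h2
            have : |w d2| = 0 := le_antisymm h2 (abs_nonneg _)
            simp [hz2, this]
        · simp only [hz1, if_false] at h1
          have : |w d1| = 0 := le_antisymm h1 (abs_nonneg _)
          simp [hz1, this]
    _ = (∑ d ∈ D, if d ≤ z then (z : ℝ) ^ 2 else 0) ^ 2 := by
        rw [sq (∑ d ∈ D, _), sum_mul_sum]
    _ ≤ ((z : ℝ) * z ^ 2) ^ 2 := by
        gcongr
        rw [← sum_filter, sum_const, nsmul_eq_mul]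
        gcongr
        have : (D.filter (· ≤ z)) ⊆ Icc 1 z := by
          intro d hd
          rw [mem_filter] at hd
          exact mem_Icc.2 ⟨Nat.pos_of_mem_divisors hd.1, hd.2⟩
        simpa using card_le_card this
    _ = _ := by ring

/-- Selberg's upper bound sieve, with a crude error term. -/
theorem siftedSum_le_selberg (hz : 1 ≤ z)
    (hnu : ∀ d, d ∣ s.prodPrimes → (s.nu d)⁻¹ ≤ d)
    (hrem : ∀ d, d ∣ s.prodPrimes → |s.rem d| ≤ d) :
    s.siftedSum ≤ s.totalMass / s.selbergSum z + (z : ℝ) ^ 6 := by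
  refine (siftedSum_le_mainSum_errSum_of_upperMoebius _
    (upperMoebius_lambdaSquared _ (s.optimalWeights_one hz))).trans ?_
  rw [s.mainSum_optimalWeights hz, div_eq_mul_inv]
  gcongr
  exact s.errSum_optimalWeights_le hz hnu hrem

end BoundingSieve

/-! ### Local densities for n(n+d). -/

/-- The arithmetic function `n ↦ ∏ p ∣ n, 2 / p`. -/
noncomputable def twoDivPrime : ArithmeticFunction ℝ :=
  ArithmeticFunction.prodPrimeFactors fun p => 2 / (p : ℝ)

theorem twoDivPrime_apply {m : ℕ} (hm : m ≠ 0) :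
    twoDivPrime m = ∏ p ∈ m.primeFactors, 2 / (p : ℝ) :=
  ArithmeticFunction.prodPrimeFactors_apply hm

theorem twoDivPrime_isMultiplicative : twoDivPrime.IsMultiplicative :=
  ArithmeticFunction.IsMultiplicative.prodPrimeFactors _

theorem inv_twoDivPrime_le {m : ℕ} (hm : Squarefree m) : (twoDivPrime m)⁻¹ ≤ m := by
  have h : ((m : ℕ) : ℝ) = ∏ p ∈ m.primeFactors, (p : ℝ) := by
    conv_lhs => rw [← Nat.prod_primeFactors_of_squarefree hm]
    push_cast; rfl
  rw [twoDivPrime_apply hm.ne_zero, h, ← prod_inv_distrib]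
  refine prod_le_prod (fun p _ => by positivity) fun p _ => ?_
  rw [inv_div]
  have : (0 : ℝ) ≤ p := by positivity
  linarith

theorem natCast_mul_twoDivPrime {m : ℕ} (hm : Squarefree m) :
    (m : ℝ) * twoDivPrime m = 2 ^ m.primeFactors.card := by
  have h : ((m : ℕ) : ℝ) = ∏ p ∈ m.primeFactors, (p : ℝ) := by
    conv_lhs => rw [← Nat.prod_primeFactors_of_squarefree hm]
    push_cast; rfl
  rw [twoDivPrime_apply hm.ne_zero, h, ← prod_mul_distrib, ← prod_const]
  refine prod_congr rfl fun p hp => ?_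
  have : (p : ℝ) ≠ 0 := by exact_mod_cast (Nat.prime_of_mem_primeFactors hp).ne_zero
  field_simp

/-- The residues `u` modulo `m` with `u (u + d) = 0`. -/
def shiftedRoots (d m : ℕ) : Set (ZMod m) := {u | u * (u + d) = 0}

theorem ncard_shiftedRoots_mul {d m n : ℕ} (h : m.Coprime n) :
    (shiftedRoots d (m * n)).ncard = (shiftedRoots d m).ncard * (shiftedRoots d n).ncard := by
  rw [← Set.ncard_prod]
  refine Set.ncard_congr (fun u _ => ZMod.chineseRemainder h u) ?_ ?_ ?_
  · intro u hu
    have := congrArg (ZMod.chineseRemainder h) hu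
    simpa [shiftedRoots, Prod.ext_iff] using this
  · intro a b _ _ hab
    exact (ZMod.chineseRemainder h).injective hab
  · rintro ⟨a, b⟩ ⟨ha, hb⟩
    refine ⟨(ZMod.chineseRemainder h).symm (a, b), ?_, by simp⟩
    apply (ZMod.chineseRemainder h).injective
    simp only [shiftedRoots, Set.mem_ofPred_eq] at ha hb
    simp [Prod.ext_iff, ha, hb]

theorem ncard_shiftedRoots_prime {d p : ℕ} (hp : p.Prime) (hd : ¬ p ∣ d) :
    (shiftedRoots d p).ncard = 2 := by
  have := Fact.mk hp
  have hne : (d : ZMod p) ≠ 0 := by rwa [Ne, ZMod.natCast_eq_zero_iff]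
  have : shiftedRoots d p = {0, -(d : ZMod p)} := by
    ext u
    simp [shiftedRoots, add_eq_zero_iff_eq_neg]
  rw [this, Set.ncard_pair]
  intro h
  exact hne (neg_eq_zero.1 h.symm)

/-- By the Chinese remainder theorem it suffices to treat primes, where 0 and -d are distinct roots
because p does not divide d. -/
theorem ncard_shiftedRoots {d : ℕ} (m : ℕ) (hm : Squarefree m) (hd : m.Coprime d) :
    (shiftedRoots d m).ncard = 2 ^ m.primeFactors.card := by
  induction m using Nat.recOnPosPrimePosCoprime with
  | zero => exact absurd rfl hm.ne_zero
  | one =>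
    have : shiftedRoots d 1 = Set.univ := by
      ext u; simp [shiftedRoots, Subsingleton.elim _ (0 : ZMod 1)]
    rw [this, Set.ncard_univ]; simp
  | prime_pow p n hp hn =>
    have hn1 : n = 1 := by
      exact ((Nat.squarefree_pow_iff hp.ne_one hn.ne').1 hm).2
    subst hn1
    rw [pow_one] at *
    rw [ncard_shiftedRoots_prime hp ((Nat.Prime.coprime_iff_not_dvd hp).1 hd)]
    simp [hp.primeFactors]
  | coprime a b ha hb hab iha ihb =>
    rw [ncard_shiftedRoots_mul hab, iha (hm.of_mul_left) hd.coprime_mul_right,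
      ihb hm.of_mul_right hd.coprime_mul_left, hab.primeFactors_mul,
      card_union_of_disjoint hab.disjoint_primeFactors, pow_add]

theorem abs_count_natCast_eq_sub_le {m : ℕ} (hm : m ≠ 0) (u : ZMod m) (N : ℕ) :
    |(((range N).filter fun n => ((n : ℕ) : ZMod m) = u).card : ℝ) - N / m| ≤ 1 := by
  have : NeZero m := ⟨hm⟩
  have h1 : ((range N).filter fun n => ((n : ℕ) : ZMod m) = u).card =
      N.count (· ≡ u.val [MOD m]) := by
    rw [Nat.count_eq_card_filter_range]
    congr 1
    refine filter_congr fun n _ => ?_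
    rw [← ZMod.natCast_eq_natCast_iff, ZMod.natCast_zmod_val]
  rw [h1, Nat.count_modEq_card _ (Nat.pos_of_ne_zero hm)]
  have hm0 : (0 : ℝ) < m := by positivity
  have h2 : (N : ℝ) / m = (N / m : ℕ) + ((N % m : ℕ) : ℝ) / m := by
    have : (N : ℝ) = m * (N / m : ℕ) + (N % m : ℕ) := by exact_mod_cast (Nat.div_add_mod N m).symm
    rw [this]
    field_simp
  have h3 : ((N % m : ℕ) : ℝ) / m ≤ 1 := by
    rw [div_le_one hm0]; exact_mod_cast (Nat.mod_lt _ (Nat.pos_of_ne_zero hm)).le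
  have h4 : 0 ≤ ((N % m : ℕ) : ℝ) / m := by positivity
  rw [h2, abs_le]
  push_cast
  split_ifs <;> constructor <;> norm_num <;> linarith

/-- The condition selects 2^ω(m) ≤ m residue classes, and each is counted with error at most 1. -/
theorem abs_count_dvd_mul_add_sub_le {d m : ℕ} (hm : Squarefree m) (hd : m.Coprime d) (N : ℕ) :
    |(((range N).filter fun n => m ∣ n * (n + d)).card : ℝ) - twoDivPrime m * N| ≤ m := by
  classical
  have : NeZero m := ⟨hm.ne_zero⟩
  set T : Finset (ZMod m) := univ.filter (fun u => u * (u + d) = 0)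
  have hT : T.card = 2 ^ m.primeFactors.card := by
    rw [← ncard_shiftedRoots m hm hd, ← Set.ncard_coe_finset]
    congr 1
    ext u; simp [T, shiftedRoots]
  have hcount : ((range N).filter fun n => m ∣ n * (n + d)).card =
      ∑ u ∈ T, ((range N).filter fun n => ((n : ℕ) : ZMod m) = u).card := by
    rw [card_eq_sum_card_fiberwise (f := fun n : ℕ => (n : ZMod m)) (t := T)]
    · refine sum_congr rfl fun u hu => ?_
      congr 1
      rw [filter_filter]
      refine filter_congr fun n _ => ?_
      constructor
      · exact fun h => h.2
      · intro h
        refine ⟨?_, h⟩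
        rw [← ZMod.natCast_eq_zero_iff]
        subst h
        simpa [T] using hu
    · intro n hn
      have := (ZMod.natCast_eq_zero_iff (n * (n + d)) m).2 (mem_filter.1 hn).2
      simpa [T] using this
  have hmain : twoDivPrime m * N = ∑ _u ∈ T, (N : ℝ) / m := by
    have hm0 : (m : ℝ) ≠ 0 := by exact_mod_cast hm.ne_zero
    rw [sum_const, hT, nsmul_eq_mul]
    push_cast
    rw [← natCast_mul_twoDivPrime hm]
    field_simp
  rw [hcount, hmain]
  push_cast
  rw [← sum_sub_distrib]
  calc _ ≤ ∑ u ∈ T, (1 : ℝ) := (abs_sum_le_sum_abs _ _).trans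
        (sum_le_sum fun u _ => abs_count_natCast_eq_sub_le hm.ne_zero u N)
    _ = T.card := by simp
    _ ≤ m := by
      have : T.card ≤ m := by simpa using card_le_univ T
      exact_mod_cast this

/-! ### The sieve problem for prime pairs. -/

/-- The product of the primes up to `z` that do not divide `d`. -/
def coprimePrimorial (d z : ℕ) : ℕ := ∏ p ∈ (Icc 1 z).filter (fun p => p.Prime ∧ ¬ p ∣ d), p

theorem dvd_coprimePrimorial_iff {d z p : ℕ} (hp : p.Prime) :
    p ∣ coprimePrimorial d z ↔ p ≤ z ∧ ¬ p ∣ d := by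
  rw [coprimePrimorial, hp.prime.dvd_finsetProd_iff]
  constructor
  · rintro ⟨q, hq, hpq⟩
    simp only [mem_filter, mem_Icc] at hq
    rw [(Nat.prime_dvd_prime_iff_eq hp hq.2.1).1 hpq]
    exact ⟨hq.1.2, hq.2.2⟩
  · rintro ⟨h1, h2⟩
    exact ⟨p, by simp [hp, h1, h2, hp.one_le], dvd_rfl⟩

theorem squarefree_prod_primes {s : Finset ℕ} (hs : ∀ p ∈ s, p.Prime) :
    Squarefree (∏ p ∈ s, p) := by
  refine Finset.squarefree_prod_of_pairwise_isCoprime ?_ ?_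
  · intro p hp q hq hpq
    exact Nat.coprime_iff_isRelPrime.1 ((Nat.coprime_primes (hs p hp) (hs q hq)).2 hpq)
  · exact fun p hp => (hs p hp).prime.squarefree

theorem squarefree_coprimePrimorial (d z : ℕ) : Squarefree (coprimePrimorial d z) :=
  squarefree_prod_primes fun _ hp => (mem_filter.1 hp).2.1

theorem dvd_coprimePrimorial {d z m : ℕ} (hm : Squarefree m) (hmd : m.Coprime d)
    (h : ∀ p, p.Prime → p ∣ m → p ≤ z) : m ∣ coprimePrimorial d z := by
  rw [← Nat.prod_primeFactors_of_squarefree hm]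
  refine prod_dvd_prod_of_subset _ _ _ fun p hp => ?_
  have hpp := Nat.prime_of_mem_primeFactors hp
  have hpm := Nat.dvd_of_mem_primeFactors hp
  simp only [mem_filter, mem_Icc]
  refine ⟨⟨hpp.one_le, h p hpp hpm⟩, hpp, fun hpd => ?_⟩
  exact hpp.ne_one (Nat.eq_one_of_dvd_coprimes hmd hpm hpd)

theorem coprimePrimorial_coprime (d z : ℕ) : (coprimePrimorial d z).Coprime d := by
  refine Nat.Coprime.prod_left fun p hp => ?_
  exact ((mem_filter.1 hp).2.1.coprime_iff_not_dvd).2 (mem_filter.1 hp).2.2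

/-- Evenness of d keeps 2 out of the sifting product, so that the density 2/p stays below 1. -/
theorem two_lt_of_dvd_coprimePrimorial {d z p : ℕ} (hd : Even d) (hp : p.Prime)
    (h : p ∣ coprimePrimorial d z) : 2 < p := by
  refine lt_of_le_of_ne hp.two_le fun h2 => ?_
  subst h2
  exact ((dvd_coprimePrimorial_iff hp).1 h).2 hd.two_dvd

/-- Lets the sieve's support, a set of values, be counted by n itself with unit weights. -/
theorem mul_add_injective (d : ℕ) : Function.Injective fun n : ℕ => n * (n + d) := by
  refine StrictMono.injective fun a b hab => ?_
  exact Nat.mul_lt_mul'' hab (by omega)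

/-- The sieve problem for the values `n (n + d)` with `n < N`. -/
noncomputable def shiftedSieve (d z N : ℕ) (hd : Even d) : BoundingSieve where
  support := (range N).image fun n => n * (n + d)
  prodPrimes := coprimePrimorial d z
  prodPrimes_squarefree := squarefree_coprimePrimorial d z
  weights := fun _ => 1
  weights_nonneg := fun _ => zero_le_one
  totalMass := N
  nu := twoDivPrime
  nu_mult := twoDivPrime_isMultiplicative
  nu_pos_of_prime := fun p hp _ => by
    have := hp.pos
    rw [twoDivPrime_apply hp.ne_zero, hp.primeFactors, prod_singleton]
    positivity
  nu_lt_one_of_prime := fun p hp h => by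
    have h0 : (0 : ℝ) < p := by exact_mod_cast hp.pos
    rw [twoDivPrime_apply hp.ne_zero, hp.primeFactors, prod_singleton, div_lt_one h0]
    exact_mod_cast two_lt_of_dvd_coprimePrimorial hd hp h

theorem card_coprime_le_selberg {d z : ℕ} (N : ℕ) (hd : Even d) (hz : 1 ≤ z) :
    (((range N).filter fun n => (coprimePrimorial d z).Coprime (n * (n + d))).card : ℝ) ≤
      N / (shiftedSieve d z N hd).selbergSum z + (z : ℝ) ^ 6 := by
  have h := (shiftedSieve d z N hd).siftedSum_le_selberg hz
    (fun m hm => inv_twoDivPrime_le ((squarefree_coprimePrimorial d z).squarefree_of_dvd hm))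
    (fun m hm => by
      have h1 := abs_count_dvd_mul_add_sub_le
        ((squarefree_coprimePrimorial d z).squarefree_of_dvd hm)
        ((coprimePrimorial_coprime d z).coprime_dvd_left hm) N
      have h2 : (shiftedSieve d z N hd).rem m =
          (((range N).filter fun n => m ∣ n * (n + d)).card : ℝ) - twoDivPrime m * N := by
        simp only [BoundingSieve.rem, BoundingSieve.multSum, shiftedSieve]
        rw [sum_image (fun a _ b _ hab => mul_add_injective d hab)]
        simp
      rw [h2]; exact h1)
  refine le_trans (le_of_eq ?_) h
  have hs : (shiftedSieve d z N hd).siftedSum = ∑ m ∈ (range N).image (fun n => n * (n + d)),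
      if (coprimePrimorial d z).Coprime m then (1 : ℝ) else 0 := rfl
  rw [hs, sum_image (fun a _ b _ hab => mul_add_injective d hab), card_filter]
  push_cast
  rfl

/-! ### Lower bound for the Selberg sum. -/

theorem sum_divisors_prod_primeFactors {n : ℕ} (hn : Squarefree n) (f : ℕ → ℝ) :
    ∑ m ∈ n.divisors, ∏ p ∈ m.primeFactors, f p = ∏ p ∈ n.primeFactors, (1 + f p) := by
  have h := (ArithmeticFunction.IsMultiplicative.prodPrimeFactors
    f).prodPrimeFactors_one_add_of_squarefree hn
  have h1 : ∏ p ∈ n.primeFactors, (1 + f p) =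
      ∏ p ∈ n.primeFactors, (1 + ArithmeticFunction.prodPrimeFactors f p) := by
    refine prod_congr rfl fun p hp => ?_
    have hpp := Nat.prime_of_mem_primeFactors hp
    rw [ArithmeticFunction.prodPrimeFactors_apply hpp.ne_zero, hpp.primeFactors, prod_singleton]
  rw [h1, h]
  refine sum_congr rfl fun m hm => ?_
  rw [ArithmeticFunction.prodPrimeFactors_apply (Nat.pos_of_mem_divisors hm).ne']

theorem prod_primeFactors_inv {n : ℕ} (hn : Squarefree n) :
    ∏ p ∈ n.primeFactors, (p : ℝ)⁻¹ = (n : ℝ)⁻¹ := by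
  conv_rhs => rw [← Nat.prod_primeFactors_of_squarefree hn]
  push_cast
  rw [prod_inv_distrib]

theorem sum_divisors_inv {n : ℕ} (hn : Squarefree n) :
    ∑ m ∈ n.divisors, (m : ℝ)⁻¹ = ∏ p ∈ n.primeFactors, (1 + (p : ℝ)⁻¹) := by
  rw [← sum_divisors_prod_primeFactors hn]
  exact sum_congr rfl fun m hm =>
    (prod_primeFactors_inv (hn.squarefree_of_dvd (Nat.dvd_of_mem_divisors hm))).symm

/-- If lcm(a, b) = l then ab = l · gcd(a, b), and b is recovered from a and gcd(a, b). The sum is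
thus at most l⁻¹ ∑_{a∣l} ∑_{g∣a} 1/g, which factors over the primes of l. -/
theorem sum_lcm_eq_inv_mul_inv_le {l : ℕ} (hl : Squarefree l) :
    ∑ q ∈ (l.divisors ×ˢ l.divisors).filter (fun q => Nat.lcm q.1 q.2 = l),
        (q.1 : ℝ)⁻¹ * (q.2 : ℝ)⁻¹ ≤
      ∏ p ∈ l.primeFactors, (p : ℝ)⁻¹ * (2 + (p : ℝ)⁻¹) := by
  have hinj : Set.InjOn (fun q : ℕ × ℕ => (⟨q.1, Nat.gcd q.1 q.2⟩ : Σ _ : ℕ, ℕ))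
      ((l.divisors ×ˢ l.divisors).filter (fun q => Nat.lcm q.1 q.2 = l) : Finset (ℕ × ℕ)) := by
    rintro ⟨a, b⟩ hab ⟨a', b'⟩ hab' h
    simp only [coe_filter, mem_product, Nat.mem_divisors, Set.mem_ofPred_eq] at hab hab'
    simp only [Sigma.mk.injEq, heq_eq_eq] at h
    obtain ⟨rfl, h2⟩ := h
    have h3 := Nat.gcd_mul_lcm a b
    have h4 := Nat.gcd_mul_lcm a b'
    rw [hab.2] at h3
    rw [hab'.2, ← h2, h3] at h4
    have ha : 0 < a := Nat.pos_of_dvd_of_pos hab.1.1.1 (Nat.pos_of_ne_zero hl.ne_zero)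
    rw [Nat.eq_of_mul_eq_mul_left ha h4]
  calc _ = ∑ q ∈ (l.divisors ×ˢ l.divisors).filter (fun q => Nat.lcm q.1 q.2 = l),
        (fun t : Σ _ : ℕ, ℕ => (l : ℝ)⁻¹ * (t.2 : ℝ)⁻¹) ⟨q.1, Nat.gcd q.1 q.2⟩ := by
        refine sum_congr rfl fun q hq => ?_
        have h := Nat.gcd_mul_lcm q.1 q.2
        rw [(mem_filter.1 hq).2] at h
        simp only
        rw [← mul_inv, ← mul_inv]
        congr 1
        rw [mul_comm (l : ℝ)]
        exact_mod_cast h.symm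
    _ = ∑ t ∈ ((l.divisors ×ˢ l.divisors).filter (fun q => Nat.lcm q.1 q.2 = l)).image
          (fun q : ℕ × ℕ => (⟨q.1, Nat.gcd q.1 q.2⟩ : Σ _ : ℕ, ℕ)),
          (l : ℝ)⁻¹ * (t.2 : ℝ)⁻¹ := by rw [sum_image hinj]
    _ ≤ ∑ t ∈ l.divisors.sigma (fun m => m.divisors), (l : ℝ)⁻¹ * (t.2 : ℝ)⁻¹ := by
        refine sum_le_sum_of_subset_of_nonneg ?_ fun _ _ _ => by positivity
        intro t ht
        obtain ⟨q, hq, rfl⟩ := mem_image.1 ht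
        have h1 := (mem_product.1 (mem_filter.1 hq).1).1
        exact mem_sigma.2 ⟨h1, Nat.mem_divisors.2 ⟨Nat.gcd_dvd_left _ _,
          (Nat.pos_of_mem_divisors h1).ne'⟩⟩
    _ = (l : ℝ)⁻¹ * ∏ p ∈ l.primeFactors, (1 + (1 + (p : ℝ)⁻¹)) := by
        rw [sum_sigma, ← sum_divisors_prod_primeFactors hl, mul_sum]
        refine sum_congr rfl fun m hm => ?_
        rw [← mul_sum, sum_divisors_inv (hl.squarefree_of_dvd (Nat.dvd_of_mem_divisors hm))]
    _ = _ := by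
        rw [prod_mul_distrib, prod_primeFactors_inv hl]
        congr 1
        exact prod_congr rfl fun p _ => by ring

/-- At each prime this is 2/p + 1/p² ≤ 2/(p - 2). -/
theorem prod_le_selbergTerms_shiftedSieve {d z N l : ℕ} (hd : Even d)
    (hl : l ∣ coprimePrimorial d z) :
    ∏ p ∈ l.primeFactors, (p : ℝ)⁻¹ * (2 + (p : ℝ)⁻¹) ≤
      (shiftedSieve d z N hd).selbergTerms l := by
  have hsq := (squarefree_coprimePrimorial d z).squarefree_of_dvd hl
  rw [BoundingSieve.selbergTerms_apply]
  change _ ≤ twoDivPrime l * ∏ p ∈ l.primeFactors, (1 - twoDivPrime p)⁻¹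
  rw [twoDivPrime_apply hsq.ne_zero, ← prod_mul_distrib]
  refine prod_le_prod (fun p _ => by positivity) fun p hp => ?_
  have hpp := Nat.prime_of_mem_primeFactors hp
  have h2 : (2 : ℝ) < p := by
    exact_mod_cast two_lt_of_dvd_coprimePrimorial hd hpp ((Nat.dvd_of_mem_primeFactors hp).trans hl)
  rw [twoDivPrime_apply hpp.ne_zero, hpp.primeFactors, prod_singleton]
  have h3 : (0 : ℝ) < p - 2 := by linarith
  have h4 : (1 - 2 / (p : ℝ))⁻¹ = p / (p - 2) := by
    field_simp
  rw [h4]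
  have h5 : 2 / (p : ℝ) * (p / (p - 2)) - (p : ℝ)⁻¹ * (2 + (p : ℝ)⁻¹) =
      (3 * p + 2) / (p ^ 2 * (p - 2)) := by
    field_simp
    ring
  have h6 : 0 ≤ (3 * (p : ℝ) + 2) / (p ^ 2 * (p - 2)) := by positivity
  linarith

/-- Expand the square and group pairs by their lcm, which is at most y² ≤ z. -/
theorem sq_sum_inv_le_selbergSum {d y z N : ℕ} (hd : Even d) (hyz : y * y ≤ z) :
    (∑ m ∈ BoundingSieve.smallDivisors (coprimePrimorial d z) y, (m : ℝ)⁻¹) ^ 2 ≤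
      (shiftedSieve d z N hd).selbergSum z := by
  set P := coprimePrimorial d z
  have hPsq : Squarefree P := squarefree_coprimePrimorial d z
  set T := BoundingSieve.smallDivisors P y
  have hmaps : ∀ q ∈ T ×ˢ T, Nat.lcm q.1 q.2 ∈ BoundingSieve.smallDivisors P z := by
    intro q hq
    obtain ⟨h1, h2⟩ := mem_product.1 hq
    obtain ⟨h1, h1y⟩ := mem_filter.1 h1
    obtain ⟨h2, h2y⟩ := mem_filter.1 h2
    refine mem_filter.2 ⟨Nat.mem_divisors.2 ⟨Nat.lcm_dvd (Nat.dvd_of_mem_divisors h1)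
      (Nat.dvd_of_mem_divisors h2), hPsq.ne_zero⟩, ?_⟩
    exact (Nat.le_of_dvd (Nat.mul_pos (Nat.pos_of_mem_divisors h1) (Nat.pos_of_mem_divisors h2))
      (Nat.lcm_dvd_mul _ _)).trans ((Nat.mul_le_mul h1y h2y).trans hyz)
  calc _ = ∑ q ∈ T ×ˢ T, (q.1 : ℝ)⁻¹ * (q.2 : ℝ)⁻¹ := by
        rw [sq, sum_mul_sum, sum_product]
    _ = ∑ l ∈ BoundingSieve.smallDivisors P z, ∑ q ∈ (T ×ˢ T).filter
          (fun q => Nat.lcm q.1 q.2 = l), (q.1 : ℝ)⁻¹ * (q.2 : ℝ)⁻¹ :=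
        (sum_fiberwise_of_maps_to hmaps _).symm
    _ ≤ ∑ l ∈ BoundingSieve.smallDivisors P z, ∑ q ∈ (l.divisors ×ˢ l.divisors).filter
          (fun q => Nat.lcm q.1 q.2 = l), (q.1 : ℝ)⁻¹ * (q.2 : ℝ)⁻¹ := by
        refine sum_le_sum fun l hl => sum_le_sum_of_subset_of_nonneg ?_ fun _ _ _ => by positivity
        intro q hq
        have hl0 := (Nat.pos_of_mem_divisors (mem_filter.1 hl).1).ne'
        obtain ⟨-, rfl⟩ := mem_filter.1 hq
        simp only [mem_filter, mem_product, Nat.mem_divisors, and_true]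
        exact ⟨⟨Nat.dvd_lcm_left _ _, hl0⟩, ⟨Nat.dvd_lcm_right _ _, hl0⟩⟩
    _ ≤ _ := by
        refine sum_le_sum fun l hl => ?_
        have hlP := Nat.dvd_of_mem_divisors (mem_filter.1 hl).1
        exact (sum_lcm_eq_inv_mul_inv_le (hPsq.squarefree_of_dvd hlP)).trans
          (prod_le_selbergTerms_shiftedSieve hd hlP)

/-- Writing n = s²q with q squarefree bounds the harmonic sum by ∑ 1/s² ≤ 2 times the squarefree
sum. -/
theorem log_le_two_mul_sum_squarefree_inv (y : ℕ) :
    Real.log (y + 1) ≤ 2 * ∑ m ∈ (Icc 1 y).filter Squarefree, (m : ℝ)⁻¹ := by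
  have h1 : Real.log (y + 1) ≤ ∑ n ∈ Icc 1 y, (n : ℝ)⁻¹ := by
    have := log_add_one_le_harmonic y
    rw [harmonic_eq_sum_Icc] at this
    push_cast at this
    exact this
  have h2 : ∑ n ∈ Icc 1 y, (n : ℝ)⁻¹ ≤
      ∑ q ∈ Icc 1 y ×ˢ (Icc 1 y).filter Squarefree, ((q.1 : ℝ) ^ 2)⁻¹ * (q.2 : ℝ)⁻¹ := by
    have hex : ∀ n ∈ Icc 1 y, ∃ q ∈ Icc 1 y ×ˢ (Icc 1 y).filter Squarefree,
        q.1 ^ 2 * q.2 = n := by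
      intro n hn
      obtain ⟨h1n, hny⟩ := mem_Icc.1 hn
      obtain ⟨a, b, ha, hb, hab, hsq⟩ := Nat.sq_mul_squarefree_of_pos (n := n) (by omega)
      have hbn : b ≤ n := Nat.le_of_dvd (by omega) ((dvd_pow_self b two_ne_zero).trans ⟨a, hab.symm⟩)
      have han : a ≤ n := Nat.le_of_dvd (by omega) ⟨b ^ 2, by rw [mul_comm, hab]⟩
      refine ⟨(b, a), ?_, hab⟩
      simp only [mem_product, mem_filter, mem_Icc]
      exact ⟨⟨hb, hbn.trans hny⟩, ⟨ha, han.trans hny⟩, hsq⟩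
    have hsub : Icc 1 y ⊆ (Icc 1 y ×ˢ (Icc 1 y).filter Squarefree).image
        (fun q : ℕ × ℕ => q.1 ^ 2 * q.2) := by
      intro n hn
      obtain ⟨q, hq, h⟩ := hex n hn
      exact mem_image.2 ⟨q, hq, h⟩
    calc _ ≤ ∑ n ∈ (Icc 1 y ×ˢ (Icc 1 y).filter Squarefree).image (fun q : ℕ × ℕ => q.1 ^ 2 * q.2),
          (n : ℝ)⁻¹ := sum_le_sum_of_subset_of_nonneg hsub fun _ _ _ => by positivity
      _ ≤ ∑ q ∈ Icc 1 y ×ˢ (Icc 1 y).filter Squarefree, ((q.1 ^ 2 * q.2 : ℕ) : ℝ)⁻¹ :=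
          sum_image_le_of_nonneg (fun _ _ => by positivity)
      _ = _ := sum_congr rfl fun q _ => by push_cast; rw [mul_inv]
  have h3 : ∑ s ∈ Icc 1 y, ((s : ℝ) ^ 2)⁻¹ ≤ 2 := by
    have := sum_Ioo_inv_sq_le (α := ℝ) 0 (y + 1)
    have he : Ioo 0 (y + 1) = Icc 1 y := by ext; simp; omega
    rw [he] at this
    simpa using this
  refine h1.trans (h2.trans ?_)
  rw [sum_product]
  simp_rw [← mul_sum]
  rw [← sum_mul]
  gcongr

/-- A squarefree m ≤ y splits as gcd(m, d) times a cofactor coprime to d; the first factors,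
divisors of the radical of d, produce the product. -/
theorem log_le_prod_mul_sum_smallDivisors {d y z : ℕ} (hd : d ≠ 0) (hyz : y ≤ z) :
    Real.log (y + 1) ≤ 2 * ((∏ p ∈ d.primeFactors, (1 + (p : ℝ)⁻¹)) *
      ∑ m ∈ BoundingSieve.smallDivisors (coprimePrimorial d z) y, (m : ℝ)⁻¹) := by
  refine (log_le_two_mul_sum_squarefree_inv y).trans ?_
  gcongr
  set r := ∏ p ∈ d.primeFactors, p
  have hr : Squarefree r := squarefree_prod_primes fun _ hp => Nat.prime_of_mem_primeFactors hp
  have hrf : r.primeFactors = d.primeFactors :=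
    Nat.primeFactors_prod fun p hp => Nat.prime_of_mem_primeFactors hp
  rw [← hrf, ← sum_divisors_inv hr, sum_mul_sum, ← sum_product']
  have hsub : (Icc 1 y).filter Squarefree ⊆
      (r.divisors ×ˢ BoundingSieve.smallDivisors (coprimePrimorial d z) y).image
        (fun q : ℕ × ℕ => q.1 * q.2) := by
    intro m hm
    obtain ⟨hm1, hmsq⟩ := mem_filter.1 hm
    obtain ⟨hm1, hmy⟩ := mem_Icc.1 hm1
    obtain ⟨e, he⟩ := Nat.gcd_dvd_left m d
    set k := Nat.gcd m d
    have hkd : k ∣ d := Nat.gcd_dvd_right m d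
    have hksq : Squarefree k := hmsq.squarefree_of_dvd ⟨e, he⟩
    have hesq : Squarefree e := hmsq.squarefree_of_dvd ⟨k, by rw [mul_comm]; exact he⟩
    have hem : e ≤ m := Nat.le_of_dvd hm1 ⟨k, by rw [mul_comm]; exact he⟩
    have hke : k.Coprime e := Nat.coprime_of_squarefree_mul (he ▸ hmsq)
    have hed : e.Coprime d := by
      refine Nat.coprime_of_dvd fun p hp hpe hpd => ?_
      have hpk : p ∣ k := Nat.dvd_gcd (hpe.trans ⟨k, by rw [mul_comm]; exact he⟩) hpd
      exact hp.ne_one (Nat.eq_one_of_dvd_coprimes hke hpk hpe)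
    refine mem_image.2 ⟨(k, e), ?_, he.symm⟩
    simp only [mem_product, BoundingSieve.smallDivisors, mem_filter, Nat.mem_divisors]
    refine ⟨⟨?_, hr.ne_zero⟩, ⟨⟨?_, (squarefree_coprimePrimorial d z).ne_zero⟩, hem.trans hmy⟩⟩
    · rw [← Nat.prod_primeFactors_of_squarefree hksq]
      exact prod_dvd_prod_of_subset _ _ _ (Nat.primeFactors_mono hkd hd)
    · refine dvd_coprimePrimorial hesq hed fun p hp hpe => ?_
      exact ((Nat.le_of_dvd (Nat.pos_of_ne_zero hesq.ne_zero) hpe).trans hem).trans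
        (hmy.trans hyz)
  refine (sum_le_sum_of_subset_of_nonneg hsub fun _ _ _ => by positivity).trans ?_
  refine (sum_image_le_of_nonneg (fun _ _ => by positivity)).trans (le_of_eq ?_)
  exact sum_congr rfl fun q _ => by push_cast; rw [mul_inv]

/-! ### Upper bound for a single difference. -/

theorem primeDifferenceCount_le {x : ℝ} {d y : ℕ} (hd0 : d ≠ 0) (hd : Even d) (hy : 1 ≤ y) :
    (primeDifferenceCount x d : ℝ) ≤
      4 * (⌊x⌋₊ + 1) * (∏ p ∈ d.primeFactors, (1 + (p : ℝ)⁻¹)) ^ 2 / Real.log (y + 1) ^ 2 +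
        2 * (y : ℝ) ^ 12 := by
  set N := ⌊x⌋₊ + 1
  set z := y * y
  set P := coprimePrimorial d z
  set B := ∏ p ∈ d.primeFactors, (1 + (p : ℝ)⁻¹)
  have hz : 1 ≤ z := Nat.mul_pos hy hy
  have hyz : y ≤ z := Nat.le_mul_self y
  -- Primes p ≤ z may themselves divide the sifting product, so they are counted trivially; the
  -- others survive the sieve.
  have hsub : (((range N ×ˢ range N).filter
      (fun q : ℕ × ℕ => q.1.Prime ∧ q.2.Prime ∧ q.1 + d = q.2)).image Prod.fst) ⊆
      Icc 1 z ∪ (range N).filter (fun n => P.Coprime (n * (n + d))) := by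
    intro p hp
    obtain ⟨⟨p', q⟩, hq, rfl⟩ := mem_image.1 hp
    obtain ⟨hr, hp1, hp2, hpq⟩ := mem_filter.1 hq
    simp only at hp1 hp2 hpq ⊢
    subst hpq
    by_cases hpz : p' ≤ z
    · exact mem_union_left _ (mem_Icc.2 ⟨hp1.one_le, hpz⟩)
    · refine mem_union_right _ (mem_filter.2 ⟨(mem_product.1 hr).1, ?_⟩)
      refine Nat.coprime_of_dvd fun r hr hrP hrn => ?_
      have hrz := ((dvd_coprimePrimorial_iff hr).1 hrP).1
      rcases hr.dvd_mul.1 hrn with h | h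
      · have := (Nat.prime_dvd_prime_iff_eq hr hp1).1 h
        omega
      · have := (Nat.prime_dvd_prime_iff_eq hr hp2).1 h
        omega
  have hcard : primeDifferenceCount x d ≤
      z + ((range N).filter fun n => P.Coprime (n * (n + d))).card := by
    rw [primeDifferenceCount, ← card_image_of_injOn (f := Prod.fst)]
    · refine (card_le_card hsub).trans ((card_union_le _ _).trans ?_)
      simp
    · rintro ⟨a, b⟩ hab ⟨a', b'⟩ hab' h
      have h1 := (mem_filter.1 hab).2.2.2
      have h2 := (mem_filter.1 hab').2.2.2
      simp only at h h1 h2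
      subst h
      rw [← h1, ← h2]
  have hsieve := card_coprime_le_selberg N hd hz
  have hS := (shiftedSieve d z N hd).selbergSum_pos hz
  have hS2 := sq_sum_inv_le_selbergSum (N := N) hd (le_refl z)
  have hlog := log_le_prod_mul_sum_smallDivisors hd0 hyz
  set S := (shiftedSieve d z N hd).selbergSum z
  set A := ∑ m ∈ BoundingSieve.smallDivisors (coprimePrimorial d z) y, (m : ℝ)⁻¹
  have hL : 0 < Real.log (y + 1) := Real.log_pos (by
    have : (1 : ℝ) ≤ y := by exact_mod_cast hy
    linarith)
  have hsq : Real.log (y + 1) ^ 2 ≤ 4 * B ^ 2 * S := by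
    calc Real.log (y + 1) ^ 2 ≤ (2 * (B * A)) ^ 2 := by gcongr
      _ = 4 * B ^ 2 * A ^ 2 := by ring
      _ ≤ _ := by gcongr
  have hmain : (N : ℝ) / S ≤ 4 * (⌊x⌋₊ + 1) * B ^ 2 / Real.log (y + 1) ^ 2 := by
    rw [div_le_div_iff₀ hS (by positivity)]
    calc (N : ℝ) * Real.log (y + 1) ^ 2 ≤ N * (4 * B ^ 2 * S) := by gcongr
      _ = _ := by simp only [N]; push_cast; ring
  have hz12 : (z : ℝ) ≤ (y : ℝ) ^ 12 := by
    have : z ≤ y ^ 12 := by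
      calc z = y ^ 2 := (sq y).symm
        _ ≤ y ^ 12 := Nat.pow_le_pow_right hy (by norm_num)
    exact_mod_cast this
  have hz6 : (z : ℝ) ^ 6 = (y : ℝ) ^ 12 := by simp only [z]; push_cast; ring
  have hc : (primeDifferenceCount x d : ℝ) ≤
      z + ((range N).filter fun n => P.Coprime (n * (n + d))).card := by exact_mod_cast hcard
  linarith

/-! ### Lower bound for the maximum: primes in residue classes modulo a primorial. -/

/-- Elementary half of Mertens' theorem: φ(P)/P = ∏(1 - 1/p) is at most the inverse of ∏(1 + 1/p),
which dominates the sum of 1/m over squarefree m ≤ w. -/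
theorem totient_mul_log_le {w : ℕ} :
    ((primorial w).totient : ℝ) * Real.log (w + 1) ≤ 2 * primorial w := by
  set P := primorial w
  have hP0 : P ≠ 0 := primorial_ne_zero w
  have hmem : ∀ p, p ∈ P.primeFactors ↔ p ≤ w ∧ p.Prime := by
    intro p
    rw [primeFactors_primorial, Nat.mem_primesLE]
  have hPsq : Squarefree P := squarefree_prod_primes fun _ hp => (mem_filter.1 hp).2
  have h1 : ∑ m ∈ (Icc 1 w).filter Squarefree, (m : ℝ)⁻¹ ≤
      ∏ p ∈ P.primeFactors, (1 + (p : ℝ)⁻¹) := by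
    rw [← sum_divisors_inv hPsq]
    refine sum_le_sum_of_subset_of_nonneg (fun m hm => ?_) fun _ _ _ => by positivity
    obtain ⟨hm1, hmsq⟩ := mem_filter.1 hm
    obtain ⟨hm1, hmw⟩ := mem_Icc.1 hm1
    refine Nat.mem_divisors.2 ⟨?_, hP0⟩
    rw [← Nat.prod_primeFactors_of_squarefree hmsq, ← Nat.prod_primeFactors_of_squarefree hPsq]
    refine prod_dvd_prod_of_subset _ _ _ fun p hp => (hmem p).2 ⟨?_, Nat.prime_of_mem_primeFactors hp⟩
    exact (Nat.le_of_dvd hm1 (Nat.dvd_of_mem_primeFactors hp)).trans hmw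
  have h2 : (P.totient : ℝ) = P * ∏ p ∈ P.primeFactors, (1 - (p : ℝ)⁻¹) := by
    have := congrArg (Rat.cast (K := ℝ)) (Nat.totient_eq_mul_prod_factors P)
    push_cast at this
    exact this
  have h3 : (∏ p ∈ P.primeFactors, (1 - (p : ℝ)⁻¹)) * ∏ p ∈ P.primeFactors, (1 + (p : ℝ)⁻¹) ≤ 1 := by
    rw [← prod_mul_distrib]
    refine prod_le_one (fun p hp => ?_) fun p hp => ?_
    · have : (p : ℝ)⁻¹ ≤ 1 := inv_le_one_of_one_le₀ (by
        exact_mod_cast (Nat.prime_of_mem_primeFactors hp).one_le)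
      have : (0 : ℝ) ≤ (p : ℝ)⁻¹ := by positivity
      apply mul_nonneg <;> linarith
    · nlinarith [sq_nonneg ((p : ℝ)⁻¹)]
  calc (P.totient : ℝ) * Real.log (w + 1)
      ≤ P.totient * (2 * ∏ p ∈ P.primeFactors, (1 + (p : ℝ)⁻¹)) := by
        gcongr
        exact (log_le_two_mul_sum_squarefree_inv w).trans (by gcongr)
    _ = 2 * P * ((∏ p ∈ P.primeFactors, (1 - (p : ℝ)⁻¹)) *
          ∏ p ∈ P.primeFactors, (1 + (p : ℝ)⁻¹)) := by rw [h2]; ring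
    _ ≤ 2 * P * 1 := by gcongr
    _ = _ := mul_one _

/-- Cauchy–Schwarz over the reduced classes modulo P bounds the left side by φ(P) times the number
of congruent pairs. Such a pair is diagonal or, up to order, has difference kP with 1 ≤ k ≤ ⌊x⌋/P,
and each such difference occurs at most M times. -/
theorem sq_card_le_totient_mul {x : ℝ} {P M : ℕ} {A : Finset ℕ}
    (hA : ∀ p ∈ A, p ≤ ⌊x⌋₊ ∧ p.Prime ∧ P.Coprime p) (hP : 0 < P)
    (hM : ∀ e : ℕ, 0 < e → primeDifferenceCount x e ≤ M) :
    A.card ^ 2 ≤ P.totient * (A.card + 2 * (⌊x⌋₊ / P * M)) := by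
  set N := ⌊x⌋₊
  set R := (range P).filter P.Coprime
  have hmaps : ∀ p ∈ A, p % P ∈ R := by
    intro p hp
    refine mem_filter.2 ⟨mem_range.2 (Nat.mod_lt _ hP), ?_⟩
    rw [Nat.coprime_comm, Nat.Coprime, ← Nat.gcd_rec]
    exact (hA p hp).2.2
  have h1 : A.card = ∑ r ∈ R, (A.filter (· % P = r)).card := card_eq_sum_card_fiberwise hmaps
  set Q := (A ×ˢ A).filter (fun q => q.1 % P = q.2 % P)
  have h2 : Q.card = ∑ r ∈ R, (A.filter (· % P = r)).card ^ 2 := by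
    rw [card_eq_sum_card_fiberwise (f := fun q => q.1 % P) (t := R)]
    · refine sum_congr rfl fun r _ => ?_
      rw [sq, ← card_product]
      congr 1
      ext ⟨a, b⟩
      simp only [Q, mem_filter, mem_product]
      constructor
      · rintro ⟨⟨⟨ha, hb⟩, hab⟩, hr⟩
        exact ⟨⟨ha, hr⟩, hb, hab ▸ hr⟩
      · rintro ⟨⟨ha, hr⟩, hb, hr'⟩
        exact ⟨⟨⟨ha, hb⟩, hr.trans hr'.symm⟩, hr⟩
    · intro q hq
      exact hmaps _ (mem_product.1 (mem_filter.1 hq).1).1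
  set D : ℕ → Finset (ℕ × ℕ) := fun e => (range (N + 1) ×ˢ range (N + 1)).filter
    (fun q : ℕ × ℕ => q.1.Prime ∧ q.2.Prime ∧ q.1 + e = q.2)
  set U := (Icc 1 (N / P)).biUnion fun k => D (k * P)
  have hU : U.card ≤ N / P * M := by
    refine (card_biUnion_le_card_mul _ _ M fun k hk => ?_).trans (by simp)
    exact hM _ (Nat.mul_pos (mem_Icc.1 hk).1 hP)
  have hlt : ∀ a ∈ A, ∀ b ∈ A, a % P = b % P → a < b → (a, b) ∈ U := by
    intro a ha b hb hab hlt
    obtain ⟨k, hk⟩ := (Nat.modEq_iff_dvd' hlt.le).1 hab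
    have hk0 : k ≠ 0 := by rintro rfl; omega
    have hbN := (hA b hb).1
    refine mem_biUnion.2 ⟨k, mem_Icc.2 ⟨Nat.one_le_iff_ne_zero.2 hk0, ?_⟩, ?_⟩
    · rw [Nat.le_div_iff_mul_le hP, mul_comm, ← hk]; omega
    · simp only [D, mem_filter, mem_product, mem_range]
      refine ⟨⟨by omega, by omega⟩, (hA a ha).2.1, (hA b hb).2.1, ?_⟩
      rw [mul_comm, ← hk]; omega
  have hQ : Q ⊆ A.diag ∪ (U ∪ U.image Prod.swap) := by
    rintro ⟨a, b⟩ hq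
    obtain ⟨hq1, hab⟩ := mem_filter.1 hq
    obtain ⟨ha, hb⟩ := mem_product.1 hq1
    rcases lt_trichotomy a b with h | h | h
    · exact mem_union_right _ (mem_union_left _ (hlt a ha b hb hab h))
    · exact mem_union_left _ (mem_diag.2 ⟨ha, h⟩)
    · exact mem_union_right _ (mem_union_right _
        (mem_image.2 ⟨(b, a), hlt b hb a ha hab.symm h, rfl⟩))
  have hQc : Q.card ≤ A.card + 2 * (N / P * M) := by
    calc Q.card ≤ _ := card_le_card hQ
      _ ≤ A.diag.card + (U.card + (U.image Prod.swap).card) :=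
          (card_union_le _ _).trans (by gcongr; exact card_union_le _ _)
      _ ≤ A.card + (N / P * M + N / P * M) := by
          rw [diag_card]
          gcongr
          exact card_image_le.trans hU
      _ = _ := by ring
  calc A.card ^ 2 = (∑ r ∈ R, (A.filter (· % P = r)).card) ^ 2 := by rw [← h1]
    _ ≤ R.card * ∑ r ∈ R, (A.filter (· % P = r)).card ^ 2 := sq_sum_le_card_mul_sum_sq
    _ = P.totient * Q.card := by rw [← h2, Nat.totient_eq_card_coprime]
    _ ≤ _ := by gcongr

theorem sq_primeCounting_sub_mul_log_le {x : ℝ} {w M : ℕ}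
    (hM : ∀ e : ℕ, 0 < e → primeDifferenceCount x e ≤ M) (hw : w ≤ Nat.primeCounting ⌊x⌋₊) :
    ((Nat.primeCounting ⌊x⌋₊ : ℝ) - w) ^ 2 * Real.log (w + 1) ≤
      2 * ⌊x⌋₊ * 4 ^ w + 4 * ⌊x⌋₊ * M := by
  set N := ⌊x⌋₊
  set P := primorial w
  have hP : 0 < P := primorial_pos w
  set A := (range (N + 1)).filter (fun p => p.Prime ∧ w < p)
  have hA : ∀ p ∈ A, p ≤ N ∧ p.Prime ∧ P.Coprime p := by
    intro p hp
    obtain ⟨hpN, hpp, hwp⟩ := mem_filter.1 hp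
    refine ⟨Nat.lt_succ_iff.1 (mem_range.1 hpN), hpp, ?_⟩
    refine ((hpp.coprime_iff_not_dvd).2 fun h => ?_).symm
    have : p ∈ P.primeFactors := Nat.mem_primeFactors.2 ⟨hpp, h, hP.ne'⟩
    rw [primeFactors_primorial, Nat.mem_primesLE] at this
    omega
  have hAcard : Nat.primeCounting N ≤ A.card + w := by
    rw [Nat.primeCounting, Nat.primeCounting', Nat.count_eq_card_filter_range]
    have hsub : (range (N + 1)).filter Nat.Prime ⊆ A ∪ Icc 1 w := by
      intro p hp
      obtain ⟨hpN, hpp⟩ := mem_filter.1 hp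
      by_cases h : w < p
      · exact mem_union_left _ (mem_filter.2 ⟨hpN, hpp, h⟩)
      · exact mem_union_right _ (mem_Icc.2 ⟨hpp.one_le, not_lt.1 h⟩)
    refine (card_le_card hsub).trans ((card_union_le _ _).trans ?_)
    simp
  have hAN : A.card ≤ N := by
    have : A ⊆ Icc 1 N := fun p hp => mem_Icc.2 ⟨(hA p hp).2.1.one_le, (hA p hp).1⟩
    simpa using card_le_card this
  have hmain := sq_card_le_totient_mul hA hP hM
  have hL : 0 ≤ Real.log ((w : ℝ) + 1) := Real.log_nonneg (by
    have : (0 : ℝ) ≤ w := by positivity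
    linarith)
  have h1 : ((Nat.primeCounting N : ℝ) - w) ^ 2 ≤ (A.card : ℝ) ^ 2 := by
    have h2 : (Nat.primeCounting N : ℝ) ≤ A.card + w := by exact_mod_cast hAcard
    have h3 : (w : ℝ) ≤ Nat.primeCounting N := by exact_mod_cast hw
    apply pow_le_pow_left₀ <;> linarith
  have h2 : (A.card : ℝ) ^ 2 ≤ P.totient * (N + 2 * (N / P * M)) := by
    calc (A.card : ℝ) ^ 2 ≤ P.totient * (A.card + 2 * ((N / P : ℕ) * M)) := by exact_mod_cast hmain
      _ ≤ _ := by
        gcongr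
        exact Nat.cast_div_le
  have hP0 : (0 : ℝ) < P := by exact_mod_cast hP
  calc _ ≤ (P.totient * (N + 2 * (N / P * M)) : ℝ) * Real.log (w + 1) := by
        gcongr; exact h1.trans h2
    _ = (P.totient * Real.log (w + 1)) * (N + 2 * (N / P * M)) := by ring
    _ ≤ (2 * P) * (N + 2 * (N / P * M)) := 
        mul_le_mul_of_nonneg_right totient_mul_log_le (by positivity)
    _ = 2 * N * P + 4 * N * M := by field_simp; ring
    _ ≤ _ := by
        gcongr
        exact_mod_cast primorial_le_four_pow w

/-! ### Choice of parameters for large x. -/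

theorem eventually_log_pow_le_mul_sqrt (n : ℕ) {ε : ℝ} (hε : 0 < ε) :
    ∀ᶠ x : ℝ in atTop, Real.log x ^ n ≤ ε * √x := by
  have h := (isLittleO_log_rpow_rpow_atTop (s := 1 / 2) (n : ℝ) (by norm_num)).bound hε
  filter_upwards [h, eventually_ge_atTop 1] with x hx hx1
  have hL := Real.log_nonneg hx1
  rw [Real.rpow_natCast, Real.norm_of_nonneg (by positivity), ← Real.sqrt_eq_rpow,
    Real.norm_of_nonneg (by positivity)] at hx
  exact hx

theorem eventually_champion_count_ge :
    ∀ᶠ x : ℝ in atTop, ∀ M : ℕ, (∀ e : ℕ, 0 < e → primeDifferenceCount x e ≤ M) →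
      x * Real.log (Real.log x) / (100 * Real.log x ^ 2) ≤ M := by
  filter_upwards [eventually_log_pow_le_mul_sqrt 2 (ε := 1 / 1000) (by norm_num),
    eventually_log_pow_le_mul_sqrt 1 (ε := 1 / 1000) (by norm_num),
    Real.tendsto_log_atTop.eventually_ge_atTop 64,
    (Real.tendsto_log_atTop.comp Real.tendsto_log_atTop).eventually_ge_atTop 1,
    eventually_ge_atTop 1000] with x h2 h1 hL hLL hx M hM
  simp only [Function.comp] at hLL
  set L := Real.log x
  set r := √x
  have hx0 : 0 < x := by linarith
  have hr : r * r = x := Real.mul_self_sqrt hx0.le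
  have hr1 : 1 ≤ r := Real.one_le_sqrt.2 (by linarith)
  have hrx : r ≤ x := by nlinarith
  -- Small enough that 4^w ≤ √x, which bounds the primorial, yet large enough that log(w + 1) ≥ (log
  -- L)/2; the latter uses √L ≤ L/8, that is L ≥ 64.
  set w := ⌊L / 8⌋₊
  have hwL : (w : ℝ) ≤ L / 8 := Nat.floor_le (by linarith)
  have hwL' : L / 8 < w + 1 := Nat.lt_floor_add_one _
  have hpi := Chebyshev.pi_ge' (x := x) (by linarith)
  have hlog2 : Real.log (x + 2) ≤ 2 * L := by
    rw [← Real.log_rpow hx0]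
    refine Real.log_le_log (by linarith) ?_
    norm_num
    nlinarith
  have hpi2 : x / (3 * L) + w ≤ Nat.primeCounting ⌊x⌋₊ := by
    refine le_trans ?_ hpi
    rw [le_div_iff₀ (by linarith)]
    have h3 : (x / (3 * L) + w) * L = x / 3 + w * L := by field_simp
    rw [h3]
    have h4 : (w : ℝ) * L ≤ L ^ 2 := by nlinarith
    have h5 := Real.log_two_gt_d9
    have h6 : (x - 1) * 0.69 ≤ (x - 1) * Real.log 2 := by
      apply mul_le_mul_of_nonneg_left <;> linarith
    linarith
  have hwpi : w ≤ Nat.primeCounting ⌊x⌋₊ := by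
    have : (0 : ℝ) ≤ x / (3 * L) := by positivity
    have : (w : ℝ) ≤ Nat.primeCounting ⌊x⌋₊ := by linarith
    exact_mod_cast this
  have hmain := sq_primeCounting_sub_mul_log_le hM hwpi
  have hN : (⌊x⌋₊ : ℝ) ≤ x := Nat.floor_le hx0.le
  have h4w : (4 : ℝ) ^ w ≤ r := by
    have h4 : Real.log 4 ≤ 2 := by
      have : Real.log 4 = 2 * Real.log 2 := by
        rw [show (4 : ℝ) = 2 ^ 2 by norm_num, Real.log_pow]; norm_num
      have := Real.log_two_lt_d9
      linarith
    rw [← Real.log_le_log_iff (by positivity) (by linarith), Real.log_pow, Real.log_sqrt hx0.le]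
    have : (w : ℝ) * Real.log 4 ≤ w * 2 := by gcongr
    linarith
  have hlogw : Real.log L / 2 ≤ Real.log (w + 1) := by
    rw [← Real.log_sqrt (by linarith)]
    refine Real.log_le_log (Real.sqrt_pos.2 (by linarith)) ?_
    refine le_trans ?_ hwL'.le
    rw [Real.sqrt_le_left (by linarith)]
    nlinarith
  have hA : (x / (3 * L)) ^ 2 * (Real.log L / 2) ≤ 2 * x * r + 4 * x * M := by
    calc _ ≤ ((Nat.primeCounting ⌊x⌋₊ : ℝ) - w) ^ 2 * Real.log (w + 1) := by
          gcongr
          linarith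
      _ ≤ 2 * ⌊x⌋₊ * 4 ^ w + 4 * ⌊x⌋₊ * M := hmain
      _ ≤ _ := by gcongr
  have hB : x * Real.log L / (72 * L ^ 2) ≤ r / 2 + M := by
    have h3 : (x / (3 * L)) ^ 2 * (Real.log L / 2) = 4 * x * (x * Real.log L / (72 * L ^ 2)) := by
      field_simp; ring
    rw [h3] at hA
    have h5 : 4 * x * (x * Real.log L / (72 * L ^ 2)) ≤ 4 * x * (r / 2 + M) := by linarith
    exact le_of_mul_le_mul_left h5 (by linarith)
  have hC : r / 2 ≤ x * Real.log L / (500 * L ^ 2) := by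
    rw [le_div_iff₀ (by positivity)]
    calc r / 2 * (500 * L ^ 2) ≤ r / 2 * (500 * (1 / 1000 * r)) := by gcongr
      _ = x / 4 := by rw [← hr]; ring
      _ ≤ x * Real.log L := by nlinarith
  have hD : x * Real.log L / (72 * L ^ 2) = x * Real.log L / L ^ 2 / 72 := by field_simp
  have hE : x * Real.log L / (500 * L ^ 2) = x * Real.log L / L ^ 2 / 500 := by field_simp
  -- The constants close up because 1/72 - 1/500 ≥ 1/100.
  have hF : x * Real.log L / (100 * L ^ 2) = x * Real.log L / L ^ 2 / 100 := by field_simp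
  have hG : 0 ≤ x * Real.log L / L ^ 2 := by positivity
  linarith

theorem eventually_primeDifferenceCount_le :
    ∀ᶠ x : ℝ in atTop, ∀ d : ℕ, d ≠ 0 → Even d → (primeDifferenceCount x d : ℝ) ≤
      5000 * x * (∏ p ∈ d.primeFactors, (1 + (p : ℝ)⁻¹)) ^ 2 / Real.log x ^ 2 := by
  filter_upwards [eventually_log_pow_le_mul_sqrt 2 (ε := 1 / 1000) (by norm_num),
    Real.tendsto_log_atTop.eventually_ge_atTop 1, eventually_ge_atTop 1000]
    with x h2 hL hx d hd0 hd
  set L := Real.log x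
  set r := √x
  set B := ∏ p ∈ d.primeFactors, (1 + (p : ℝ)⁻¹)
  have hx0 : 0 < x := by linarith
  have hr : r * r = x := Real.mul_self_sqrt hx0.le
  have hr0 : 0 ≤ r := Real.sqrt_nonneg x
  have hB : 1 ≤ B := by
    rw [← prod_const_one (s := d.primeFactors) (M := ℝ)]
    refine prod_le_prod (fun _ _ => zero_le_one) fun p _ => ?_
    have : (0 : ℝ) ≤ (p : ℝ)⁻¹ := by positivity
    linarith
  -- The exponent makes the sieve error y¹² at most √x, while log(y + 1) is still at least (log
  -- x)/24.
  set t := x ^ (1 / 24 : ℝ)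
  have ht1 : 1 ≤ t := Real.one_le_rpow (by linarith) (by norm_num)
  set y := ⌊t⌋₊
  have hy1 : 1 ≤ y := Nat.one_le_floor_iff _ |>.2 ht1
  have hyt : (y : ℝ) ≤ t := Nat.floor_le (by linarith)
  have hy12 : (y : ℝ) ^ 12 ≤ r := by
    calc (y : ℝ) ^ 12 ≤ t ^ 12 := by gcongr
      _ = r := by
        change _ = √x
        rw [← Real.rpow_natCast, ← Real.rpow_mul hx0.le, Real.sqrt_eq_rpow]
        norm_num
  have hlog : L / 24 ≤ Real.log (y + 1) := by
    calc L / 24 = Real.log t := by rw [Real.log_rpow hx0]; ring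
      _ ≤ _ := Real.log_le_log (by linarith) (Nat.lt_floor_add_one t).le
  have hN : (⌊x⌋₊ : ℝ) ≤ x := Nat.floor_le hx0.le
  refine (primeDifferenceCount_le hd0 hd hy1).trans ?_
  have h3 : 4 * (⌊x⌋₊ + 1) * B ^ 2 / Real.log (y + 1) ^ 2 ≤
      4 * (x + x / 100) * B ^ 2 / (L / 24) ^ 2 := by
    gcongr
    linarith
  have h4 : 4 * (x + x / 100) * B ^ 2 / (L / 24) ^ 2 = 2304 * (101 / 100) * (x * B ^ 2 / L ^ 2) := by
    field_simp
    ring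
  have h5 : r ≤ x * B ^ 2 / L ^ 2 := by
    rw [le_div_iff₀ (by positivity)]
    calc r * L ^ 2 ≤ r * (1 / 1000 * r) := by gcongr
      _ = x / 1000 := by rw [← hr]; ring
      _ ≤ x * 1 ^ 2 := by linarith
      _ ≤ x * B ^ 2 := by gcongr
  have h6 : 5000 * x * B ^ 2 / L ^ 2 = 5000 * (x * B ^ 2 / L ^ 2) := by ring
  have h7 : 0 ≤ x * B ^ 2 / L ^ 2 := by positivity
  linarith

theorem primeDifferenceCount_le_one_of_odd {x : ℝ} {d : ℕ} (hd : Odd d) :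
    primeDifferenceCount x d ≤ 1 := by
  rw [primeDifferenceCount]
  refine (card_le_card (t := {(2, 2 + d)}) ?_).trans (by simp)
  rintro ⟨p, q⟩ h
  obtain ⟨-, hp, hq, hpq⟩ := mem_filter.1 h
  simp only at hp hq hpq
  have hp2 : p = 2 := by
    by_contra hne
    have hpo := hp.odd_of_ne_two hne
    have hq2 : q = 2 := hq.even_iff.1 (hpq ▸ hpo.add_odd hd)
    have := hp.two_le
    have := hd.pos
    omega
  subst hp2
  simp [← hpq]

/-! ### Comparison of the two bounds at a champion. -/

theorem eventually_champion_sum_inv_ge :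
    ∀ᶠ x : ℝ in atTop, ∀ d ∈ primeDifferenceChampions x,
      1 / 4 * Real.log (Real.log (Real.log x)) ≤ ∑ p ∈ d.primeFactors, (1 : ℝ) / (p : ℝ) := by
  have hLL := Real.tendsto_log_atTop.comp Real.tendsto_log_atTop
  filter_upwards [eventually_champion_count_ge, eventually_primeDifferenceCount_le,
    eventually_log_pow_le_mul_sqrt 2 (ε := 1 / 1000) (by norm_num),
    Real.tendsto_log_atTop.eventually_ge_atTop 1,
    hLL.eventually_ge_atTop 1,
    -- The two bounds lose 100 · 5000 = 500000 in total. Past this threshold that loss takes at most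
    -- half of log log log x, and the square on the product halves it again, hence 1/4.
    (Real.tendsto_log_atTop.comp hLL).eventually_ge_atTop (2 * Real.log 500000),
    eventually_ge_atTop 1000] with x hlow hup h2 hL hLL1 hLLL hx d hd
  simp only [Function.comp] at hLL1 hLLL
  obtain ⟨hd0, hmax⟩ := hd
  have hge := hlow _ hmax
  set L := Real.log x
  have hx0 : 0 < x := by linarith
  have hr : √x * √x = x := Real.mul_self_sqrt hx0.le
  have hr1 : 1 ≤ √x := Real.one_le_sqrt.2 (by linarith)
  -- The sieve bound needs d even; an odd d has at most one pair, too few for a champion.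
  have heven : Even d := by
    by_contra hodd
    have h1 : (primeDifferenceCount x d : ℝ) ≤ 1 := by
      exact_mod_cast primeDifferenceCount_le_one_of_odd (Nat.not_even_iff_odd.1 hodd)
    have h3 := hge.trans h1
    rw [div_le_one (by positivity)] at h3
    nlinarith
  have hle := hge.trans (hup d hd0.ne' heven)
  set B := ∏ p ∈ d.primeFactors, (1 + (p : ℝ)⁻¹)
  have hB : Real.log L / 500000 ≤ B ^ 2 := by
    have h3 : x * Real.log L / (100 * L ^ 2) = 5000 * x / L ^ 2 * (Real.log L / 500000) := by
      field_simp; norm_num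
    have h4 : 5000 * x * B ^ 2 / L ^ 2 = 5000 * x / L ^ 2 * B ^ 2 := by ring
    rw [h3, h4] at hle
    exact le_of_mul_le_mul_left hle (by positivity)
  have hexp : B ≤ Real.exp (∑ p ∈ d.primeFactors, (1 : ℝ) / (p : ℝ)) := by
    have : B ≤ Real.exp (∑ p ∈ d.primeFactors, (p : ℝ)⁻¹) := by
      rw [Real.exp_sum]
      refine prod_le_prod (fun p _ => by positivity) fun p _ => ?_
      rw [add_comm]
      exact Real.add_one_le_exp _
    simpa [one_div] using this
  set σ := ∑ p ∈ d.primeFactors, (1 : ℝ) / (p : ℝ)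
  have h5 : Real.log L / 500000 ≤ Real.exp (2 * σ) := by
    refine hB.trans ?_
    rw [two_mul, Real.exp_add, ← sq]
    have : 0 ≤ B := prod_nonneg fun p _ => by positivity
    gcongr
  have h6 := Real.log_le_log (by positivity) h5
  rw [Real.log_exp, Real.log_div (by linarith) (by norm_num)] at h6
  linarith

theorem theorem2 :
    (∀ dstar : ℝ → ℕ,
      (∀ᶠ x : ℝ in Filter.atTop, dstar x ∈ primeDifferenceChampions x) →
        Filter.Tendsto dstar Filter.atTop Filter.atTop ∧
        Filter.Tendsto (fun x : ℝ => (dstar x).primeFactors.card) Filter.atTop Filter.atTop) ∧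
    (∃ c : ℝ, 0 < c ∧ ∀ᶠ x : ℝ in Filter.atTop, ∀ d ∈ primeDifferenceChampions x,
      c * Real.log (Real.log (Real.log x)) ≤ ∑ p ∈ d.primeFactors, (1 : ℝ) / (p : ℝ)) := by
  refine ⟨fun dstar hdstar => ?_, 1 / 4, by norm_num, eventually_champion_sum_inv_ge⟩
  have hcard : Tendsto (fun x : ℝ => (dstar x).primeFactors.card) atTop atTop := by
    rw [← tendsto_natCast_atTop_iff (R := ℝ)]
    have hlll := (Real.tendsto_log_atTop.comp
      (Real.tendsto_log_atTop.comp Real.tendsto_log_atTop)).const_mul_atTop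
      (show (0 : ℝ) < 1 / 4 by norm_num)
    refine tendsto_atTop_mono' _ ?_ hlll
    filter_upwards [hdstar, eventually_champion_sum_inv_ge] with x hx h
    refine (h _ hx).trans ?_
    calc _ ≤ ∑ p ∈ (dstar x).primeFactors, (1 : ℝ) := by
          refine sum_le_sum fun p hp => ?_
          have hp1 : (1 : ℝ) ≤ p := by exact_mod_cast (Nat.prime_of_mem_primeFactors hp).one_le
          rw [div_le_one (by linarith)]
          exact hp1
      _ = _ := by simp
  refine ⟨tendsto_atTop_mono (fun x => ?_) hcard, hcard⟩
  have hsub : (dstar x).primeFactors ⊆ Icc 1 (dstar x) := fun p hp =>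
    mem_Icc.2 ⟨(Nat.prime_of_mem_primeFactors hp).one_le, Nat.le_of_mem_primeFactors hp⟩
  simpa using card_le_card hsub
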